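/- Let $n\ge 0$, $p\ge 1$, let $\Sigma\in\mathbb R^{p\times p}$ be a known positive definite matrix and let $X\in\mathbb R^{n\times p}$ be a random matrix with independent rows $X_i\sim\mathcal N_p(\mu_i,\Sigma)$, i.e. $X\sim\mathcal{MN}_{n\times p}(\mu,I_n,\Sigma)$. *Randomized clustering.* Let $\tau>0$, and for every pair $M=(C_1,C_2)$ of subsets of $\{1,\dots,n\}$ let $x\mapsto d(M;x)\in\mathbb R$ be a measurable function of the data matrix (the dissimilarity of the two clusters). Put $\mathcal C^{(0)}=\{\{1\},\dots,\{n\}\}$. At step $s=0,1,2,\dots$ let $\mathcal M^{(s)}$ be the set of all unordered pairs of distinct clusters in $\mathcal C^{(s)}$ (each pair being listed once, first the cluster with the smaller least element), and put $$\tau^{(s)}(x)=\tau\cdot\frac1{|\mathcal M^{(s)}|}\sum_{M'\in\mathcal M^{(s)}}d(M';x),\qquad p^{(s)}(M;x)=\frac{\exp\left(-d(M;x)/\tau^{(s)}(x)\right)}{\sum_{M'\in\mathcal M^{(s)}}\exp\left(-d(M';x)/\tau^{(s)}(x)\right)}\quad(M\in\mathcal M^{(s)}),$$ where the sampling is understood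 to be uniform on $\mathcal M^{(s)}$ if $\tau^{(s)}(x)=0$. Given $X$ and the earlier merges $M^{(0)},\dots,M^{(s-1)}$, the merge $M^{(s)}=(C_1,C_2)$ is sampled from $\mathcal M^{(s)}$ with the probabilities $p^{(s)}(\,\cdot\,;X)$, and then $\mathcal C^{(s+1)}=(\mathcal C^{(s)}\setminus\{C_1,C_2\})\cup\{C_1\cup C_2\}$. *Test.* Let $m=(M_o^{(0)},\dots,M_o^{(t)})$ be a possible sequence of merges: each $M_o^{(s)}$ lies in the set $\mathcal M^{(s)}$ determined by $M_o^{(0)},\dots,M_o^{(s-1)}$. Write $M_o^{(t)}=(C_1,C_2)$ and let $\nu\in\mathbb R^n$ have entries $\nu_i=\mathbf 1\{i\in C_1\}/|C_1|-\mathbf 1\{i\in C_2\}/|C_2|$. Define the test statistic and the auxiliary statistics $$U=\big\|\Sigma^{-1/2}X^{\top}\nu\big\|_2,\qquad \mathcal A=(\xi,\pi),\quad \xi=\Big(\frac{\Sigma^{-1/2}X^{\top}\nu}{\|\Sigma^{-1/2}X^{\top}\nu\|_2}\Big)^{\!\top},\quad \pi=\Big(I_n-\frac{\nu\nu^{\top}}{\|\nu\|_2^2}\Big)X,$$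 (with $\xi=0$ if $\Sigma^{-1/2}X^\top\nu=0$), and for $u>0$ put $X(u;\mathcal A)=u\,\frac{\nu}{\|\nu\|_2^2}\,\xi\,\Sigma^{1/2}+\pi$. Let $\ell$ be the density of $\|\nu\|_2\cdot\chi_p$, let $$\mathbb F(u;\mathcal A,m)=\frac{\int_0^{u}\ell(v)\prod_{s=0}^{t}p^{(s)}\big(M_o^{(s)};X(v;\mathcal A)\big)\,dv}{\int_0^{\infty}\ell(v)\prod_{s=0}^{t}p^{(s)}\big(M_o^{(s)};X(v;\mathcal A)\big)\,dv},$$ where $p^{(s)}(M_o^{(s)};\cdot)$ is computed with the clusters obtained from $M_o^{(0)},\dots,M_o^{(s-1)}$, and define the p-value $\mathbf P_\Sigma(U;\mathcal A)=1-\mathbb F(U;\mathcal A,m)$. **Theorem.** Under the null hypothesis $\frac1{|C_1|}\sum_{i\in C_1}\mu_i=\frac1{|C_2|}\sum_{i\in C_2}\mu_i$ we have, for every $\alpha\in[0,1]$, $$\mathbb P\left(\mathbf P_\Sigma(U;\mathcal A)\le\alpha\;\middle|\;M^{(0)}=M_o^{(0)},\dots,M^{(t)}=M_o^{(t)}\right)=\alpha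 .$$ -/

import Mathlib

open MeasureTheory ProbabilityTheory

open scoped MatrixOrder

namespace RandClust

noncomputable section

/-! ### Data, merges and the randomized agglomerative clustering algorithm -/

/-- An `n × p` real data matrix, given by its `n` rows in `ℝᵖ`. -/
abbrev Data (n p : ℕ) : Type := Fin n → EuclideanSpace ℝ (Fin p)

/-- A pair of clusters. -/
abbrev Merge (n : ℕ) : Type := Finset (Fin n) × Finset (Fin n)

/-- The matrix normal law `MN(μ, I_n, S)`: the rows are independent, row `i` is `N_p(μ_i, S)`. -/
def matrixNormal {n p : ℕ} (μ : Data n p) (S : Matrix (Fin p) (Fin p) ℝ) : Measure (Data n p) :=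
  Measure.pi fun i => multivariateGaussian (μ i) S

/-- The clusters that exist before step `s` when the merges `m 0, …, m (s - 1)` have been made
(steps are numbered from `0`), starting from the singletons. -/
def existing {n : ℕ} (m : ℕ → Merge n) : ℕ → Finset (Finset (Fin n))
  | 0 => Finset.univ.image fun i => {i}
  | s + 1 => insert ((m s).1 ∪ (m s).2) ((existing m s \ {(m s).1, (m s).2}))

/-- The candidate merges: all pairs of distinct clusters. The clusters are nonempty and disjoint,
so listing the one with the smaller least element first makes each unordered pair occur once. -/
def candidates {n : ℕ} (C : Finset (Finset (Fin n))) : Finset (Merge n) :=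
  (C ×ˢ C).filter fun m => m.1.min < m.2.min

/-- The randomization scale at a step: `τ` times the average dissimilarity of the candidates. -/
def temp {n p : ℕ} (d : Merge n → Data n p → ℝ) (τ : ℝ) (C : Finset (Finset (Fin n)))
    (x : Data n p) : ℝ :=
  τ * ((1 / ((candidates C).card : ℝ)) * ∑ M ∈ candidates C, d M x)

/-- The probability of sampling the merge `M` when the existing clusters are `C` and the data are
`x`: the softmax, over the candidates, of minus the dissimilarity divided by the scale. -/
def selProb {n p : ℕ} (d : Merge n → Data n p → ℝ) (τ : ℝ) (C : Finset (Finset (Fin n)))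
    (M : Merge n) (x : Data n p) : ℝ :=
  if M ∈ candidates C then
    Real.exp (-(1 / temp d τ C x) * d M x) /
      ∑ M' ∈ candidates C, Real.exp (-(1 / temp d τ C x) * d M' x)
  else 0

/-- The σ-algebra generated by the data and by the merges made before step `s`. -/
abbrev past {Ω : Type*} {n p : ℕ} (X : Ω → Data n p) (M : ℕ → Ω → Merge n) (s : ℕ) :
    MeasurableSpace Ω :=
  MeasurableSpace.comap X inferInstance ⊔ ⨆ r : Fin s, MeasurableSpace.comap (M r) ⊤

/-- `M 0, …, M t` are the merges made in steps `0, …, t` by the randomized algorithm run on the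
random data `X`: given the data and the earlier merges, each merge is sampled afresh with
the probabilities `selProb`. -/
structure IsRandomizedClustering {Ω : Type*} [MeasurableSpace Ω] {n p : ℕ} (P : Measure Ω)
    (d : Merge n → Data n p → ℝ) (τ : ℝ) (X : Ω → Data n p) (M : ℕ → Ω → Merge n) (t : ℕ) :
    Prop where
  measurableSet_eq : ∀ s ≤ t, ∀ m : Merge n, MeasurableSet {ω | M s ω = m}
  condProb_eq : ∀ s ≤ t, ∀ m : Merge n,
    P[Set.indicator {ω | M s ω = m} (fun _ => (1 : ℝ)) | past X M s]
      =ᵐ[P] fun ω => selProb d τ (existing (fun r => M r ω) s) m (X ω)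

/-- `m 0, …, m t` is a possible sequence of merges: each of them is a candidate when it is made. -/
def IsMergeSequence {n : ℕ} (m : ℕ → Merge n) (t : ℕ) : Prop :=
  ∀ s ≤ t, m s ∈ candidates (existing m s)

/-- The event that the first merges, up to step `t`, are `m 0, …, m t`. -/
def mergeEvent {Ω : Type*} {n : ℕ} (M : ℕ → Ω → Merge n) (m : ℕ → Merge n) (t : ℕ) : Set Ω :=
  {ω | ∀ s ≤ t, M s ω = m s}

/-! ### Null hypothesis, test statistic, auxiliary statistics -/

/-- The mean of the rows of `x` that belong to the cluster `C`. -/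
def clusterMean {n p : ℕ} (x : Data n p) (C : Finset (Fin n)) : EuclideanSpace ℝ (Fin p) :=
  (1 / (C.card : ℝ)) • ∑ i ∈ C, x i

/-- The contrast vector `ν_M`. -/
def nu {n : ℕ} (M : Merge n) : EuclideanSpace ℝ (Fin n) :=
  WithLp.toLp 2 fun i =>
    (if i ∈ M.1 then 1 / (M.1.card : ℝ) else 0) - (if i ∈ M.2 then 1 / (M.2.card : ℝ) else 0)

/-- `S^{1/2}` acting on `ℝᵖ`. -/
def sqrtMul {p : ℕ} (S : Matrix (Fin p) (Fin p) ℝ) (v : EuclideanSpace ℝ (Fin p)) :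
    EuclideanSpace ℝ (Fin p) :=
  WithLp.toLp 2 ((CFC.sqrt S).mulVec v.ofLp)

/-- `S^{-1/2}` acting on `ℝᵖ`. -/
def invSqrtMul {p : ℕ} (S : Matrix (Fin p) (Fin p) ℝ) (v : EuclideanSpace ℝ (Fin p)) :
    EuclideanSpace ℝ (Fin p) :=
  WithLp.toLp 2 ((CFC.sqrt S)⁻¹.mulVec v.ofLp)

/-- The whitened difference of cluster means `S^{-1/2} Xᵀ ν_M`. -/
def whitened {n p : ℕ} (S : Matrix (Fin p) (Fin p) ℝ) (M : Merge n) (x : Data n p) :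
    EuclideanSpace ℝ (Fin p) :=
  invSqrtMul S (∑ i, nu M i • x i)

/-- The test statistic `U = ‖S^{-1/2} Xᵀ ν_M‖₂`. -/
def statU {n p : ℕ} (S : Matrix (Fin p) (Fin p) ℝ) (M : Merge n) (x : Data n p) : ℝ :=
  ‖whitened S M x‖

/-- The auxiliary statistics: `ξ`, the direction of `S^{-1/2} Xᵀ ν_M`, and
`π = (I - ν_M ν_Mᵀ / ‖ν_M‖²) X`. -/
def aux {n p : ℕ} (S : Matrix (Fin p) (Fin p) ℝ) (M : Merge n) (x : Data n p) :
    EuclideanSpace ℝ (Fin p) × Data n p :=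
  (‖whitened S M x‖⁻¹ • whitened S M x,
    fun i => x i - (nu M i / ‖nu M‖ ^ 2) • ∑ j, nu M j • x j)

/-- The data matrix with test statistic `u` and auxiliary statistics `a = (ξ, π)`:
`u (ν_M / ‖ν_M‖²) ξᵀ S^{1/2} + π` (with `S^{1/2}` symmetric). -/
def recon {n p : ℕ} (S : Matrix (Fin p) (Fin p) ℝ) (M : Merge n) (u : ℝ)
    (a : EuclideanSpace ℝ (Fin p) × Data n p) : Data n p :=
  fun i => (u * (nu M i / ‖nu M‖ ^ 2)) • sqrtMul S a.1 + a.2 i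

/-! ### The conditional CDF and the p-value -/

/-- The density of `c · χ_p`, for `c > 0`. -/
def scaledChiPDF (p : ℕ) (c u : ℝ) : ℝ :=
  if 0 < u then
    c⁻¹ * (2 ^ (1 - (p : ℝ) / 2) / Real.Gamma ((p : ℝ) / 2) *
      (u / c) ^ ((p : ℝ) - 1) * Real.exp (-(u / c) ^ 2 / 2))
  else 0

/-- The chi density times the probability of sampling `m 0, …, m t` on the data with test
statistic `u` and auxiliary statistics `a`. -/
def weight {n p : ℕ} (d : Merge n → Data n p → ℝ) (τ : ℝ) (S : Matrix (Fin p) (Fin p) ℝ)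
    (m : ℕ → Merge n) (t : ℕ) (a : EuclideanSpace ℝ (Fin p) × Data n p) (u : ℝ) : ℝ :=
  scaledChiPDF p ‖nu (m t)‖ u *
    ∏ s ∈ Finset.range (t + 1), selProb d τ (existing m s) (m s) (recon S (m t) u a)

/-- The conditional CDF of the test statistic, evaluated at `u`. -/
def condCDF {n p : ℕ} (d : Merge n → Data n p → ℝ) (τ : ℝ) (S : Matrix (Fin p) (Fin p) ℝ)
    (m : ℕ → Merge n) (t : ℕ) (u : ℝ) (a : EuclideanSpace ℝ (Fin p) × Data n p) : ℝ :=
  (∫ v in Set.Ioc 0 u, weight d τ S m t a v) / ∫ v in Set.Ioi 0, weight d τ S m t a v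

/-- The conditional p-value, as a function of test statistic and auxiliary statistics. -/
def pValue {n p : ℕ} (d : Merge n → Data n p → ℝ) (τ : ℝ) (S : Matrix (Fin p) (Fin p) ℝ)
    (m : ℕ → Merge n) (t : ℕ) (u : ℝ) (a : EuclideanSpace ℝ (Fin p) × Data n p) : ℝ :=
  1 - condCDF d τ S m t u a

end

end RandClust

/-! The data matrix is equivalent to the pair `(U, 𝒜)`: `recon` recovers it from the two statistics.
Under the null hypothesis these are independent. Write the rows as `μ i + S^{1/2} z i` with standard
Gaussian `z i`. Since the contrast of `μ` vanishes, `U` and `ξ` are the norm and direction of the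
contrast `∑ ν_i z_i`, and `π` is a function of the residual of `z` along `ν`. Contrast and residual
are jointly Gaussian and uncorrelated, hence independent (`map_contrast_residual`); the contrast is
isotropic, so its norm is scaled chi and independent of its direction
(`map_norm_direction_eq_prod`). Thus `(U, 𝒜)` has law `ℓ(u) du ⊗ Q` (`map_statU_aux`).

By the chain rule, the observed merges have probability `∏ selProb` given `X`
(`map_restrict_merges`). Hence on the merge event `(U, 𝒜)` has the unnormalized law `weight a u du
dQ(a)` (`exists_measure_mergeEvent`). For fixed `a` the p-value is the normalized tail of `weight a`
at `u`, so the probability integral transform (`lintegral_survival_le`) gives `{P ≤ α}` exactly the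
fraction `α` of the mass of the fibre. Integrating over `a` and dividing by the probability of the
event gives `α`; no conditional law of `U` has to be constructed. -/

open Set in
/-- **Probability integral transform**: if `w > 0` is an unnormalized density on `(0, ∞)`, then the
survival function is uniformly distributed. -/
theorem lintegral_survival_le {w : ℝ → ℝ} (hpos : ∀ v, 0 < v → 0 < w v) (hint : Integrable w)
    {α : ℝ} (hα0 : 0 ≤ α) (hα1 : α ≤ 1) :
    ∫⁻ u in Ioi 0 ∩ {u | 1 - (∫ v in Ioc 0 u, w v) / (∫ v in Ioi 0, w v) ≤ α},
        ENNReal.ofReal (w u)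
      = ENNReal.ofReal α * ∫⁻ u in Ioi 0, ENNReal.ofReal (w u) := by
  have hG : ∀ u, 0 ≤ u → ∫⁻ v in Ioi u, ENNReal.ofReal (w v)
      = ENNReal.ofReal (∫ v in Ioi u, w v) := fun u hu =>
    (ofReal_integral_eq_lintegral_ofReal hint.integrableOn <|
      (ae_restrict_mem measurableSet_Ioi).mono fun v hv => (hpos v (hu.trans_lt hv)).le).symm
  have hadd : ∀ u x, 0 ≤ u → u ≤ x →
      ∫ v in Ioi u, w v = (∫ v in Ioc u x, w v) + ∫ v in Ioi x, w v := fun u x _ hx => by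
    rw [← setIntegral_union (Ioc_disjoint_Ioi le_rfl) measurableSet_Ioi hint.integrableOn
      hint.integrableOn, Ioc_union_Ioi_eq_Ioi hx]
  have hIoc : ∀ u x, 0 ≤ u → u < x → 0 < ∫ v in Ioc u x, w v := fun u x hu hx => by
    rw [← intervalIntegral.integral_of_le hx.le]
    exact intervalIntegral.intervalIntegral_pos_of_pos_on hint.intervalIntegrable
      (fun v hv => hpos v (hu.trans_lt hv.1)) hx
  have hIoi : ∀ u, 0 ≤ u → 0 < ∫ v in Ioi u, w v := fun u hu => by
    rw [hadd u (u + 1) hu (by linarith)]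
    exact add_pos_of_pos_of_nonneg (hIoc _ _ hu (by linarith)) <|
      setIntegral_nonneg measurableSet_Ioi fun v hv =>
        (hpos v (by linarith [mem_Ioi.1 hv])).le
  set Z := ∫ v in Ioi 0, w v with hZ
  have hZpos : 0 < Z := hIoi 0 le_rfl
  -- The survival function is the tail integral divided by `Z`, so the event compares a strictly
  -- decreasing tail with `α * Z`.
  have hmem : ∀ u, 0 < u → (1 - (∫ v in Ioc 0 u, w v) / Z ≤ α ↔
      ∫ v in Ioi u, w v ≤ α * Z) := fun u hu => by
    have h := hadd 0 u le_rfl hu.le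
    rw [← hZ] at h
    rw [show 1 - (∫ v in Ioc 0 u, w v) / Z = (∫ v in Ioi u, w v) / Z by
      rw [eq_div_iff hZpos.ne', sub_mul, div_mul_cancel₀ _ hZpos.ne']; linarith,
      div_le_iff₀ hZpos]
  -- For `α = 0` no finite quantile exists: every tail is positive, and the event is empty.
  rcases hα0.eq_or_lt with rfl | hα
  · have : Ioi 0 ∩ {u | 1 - (∫ v in Ioc 0 u, w v) / Z ≤ 0} = ∅ := by
      ext u
      simp only [mem_inter_iff, mem_Ioi, mem_ofPred_eq, mem_empty_iff_false, iff_false, not_and]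
      intro hu
      rw [hmem u hu, zero_mul, not_le]
      exact hIoi u hu.le
    rw [this]
    simp
  -- The `(1 - α)`-quantile, by the intermediate value theorem: the primitive is continuous, starts
  -- at `0` and tends to `Z > (1 - α) * Z`.
  · obtain ⟨u₀, hu₀, hFu₀⟩ : ∃ u₀, 0 ≤ u₀ ∧ ∫ v in (0 : ℝ)..u₀, w v = (1 - α) * Z := by
      have hcont := intervalIntegral.continuous_primitive (μ := volume)
        (fun a b => hint.intervalIntegrable (a := a) (b := b)) 0
      have hlim := intervalIntegral_tendsto_integral_Ioi 0 (hint.integrableOn (s := Ioi 0))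
        Filter.tendsto_id
      obtain ⟨b, hb, hb0⟩ := ((hlim.eventually_const_lt
        (show (1 - α) * Z < Z by nlinarith)).and (Filter.eventually_ge_atTop 0)).exists
      obtain ⟨u₀, hu₀, h⟩ := intermediate_value_Icc hb0 hcont.continuousOn
        (show (1 - α) * Z ∈ _ from ⟨by simpa using mul_nonneg (by linarith) hZpos.le, hb.le⟩)
      exact ⟨u₀, hu₀.1, h⟩
    have hGu₀ : ∫ v in Ioi u₀, w v = α * Z := by
      have h := hadd 0 u₀ le_rfl hu₀
      rw [← intervalIntegral.integral_of_le hu₀, hFu₀, ← hZ] at h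
      linarith
    have hset : Ioi 0 ∩ {u | 1 - (∫ v in Ioc 0 u, w v) / Z ≤ α} = Ioi 0 ∩ Ici u₀ := by
      ext u
      refine and_congr_right fun hu => ?_
      rw [mem_ofPred_eq, hmem u hu, ← hGu₀, mem_Ici]
      constructor
      · intro h
        by_contra! hlt
        linarith [hadd u u₀ (le_of_lt hu) hlt.le, hIoc u u₀ (le_of_lt hu) hlt]
      · intro hle
        rw [hadd u₀ u hu₀ hle]
        have : 0 ≤ ∫ v in Ioc u₀ u, w v := setIntegral_nonneg measurableSet_Ioc fun v hv =>
          (hpos v (hu₀.trans_lt hv.1)).le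
        linarith
    have hae : (Ioi 0 ∩ Ici u₀ : Set ℝ) =ᵐ[volume] Ioi u₀ := by
      have h : (Ioi 0 ∩ Ici u₀ : Set ℝ) =ᵐ[volume] (Ioi 0 ∩ Ioi u₀ : Set ℝ) :=
        (ae_eq_refl _).inter Ioi_ae_eq_Ici.symm
      rwa [inter_eq_right.2 (Ioi_subset_Ioi hu₀)] at h
    rw [hset, setLIntegral_congr hae, hG u₀ hu₀, hGu₀, hG 0 le_rfl, ENNReal.ofReal_mul hα0]

/-! ### Isotropic Gaussian densities and polar coordinates -/

/-- An isotropic Gaussian law has the density proportional to `exp (-‖x‖² / (2c²))`. -/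
theorem eq_withDensity_of_charFun {E : Type*} [NormedAddCommGroup E] [InnerProductSpace ℝ E]
    [FiniteDimensional ℝ E] [MeasurableSpace E] [BorelSpace E] (P : Measure E)
    [IsProbabilityMeasure P] {b : ℝ} (hb : 0 < b)
    (hP : ∀ t, charFun P t = Complex.exp (-(‖t‖ ^ 2 / (4 * b) : ℝ))) :
    ∃ κ : ℝ, 0 ≤ κ ∧
      P = volume.withDensity fun x => ENNReal.ofReal (κ * Real.exp (-b * ‖x‖ ^ 2)) := by
  have hint : Integrable (fun x : E => Real.exp (-b * ‖x‖ ^ 2)) := by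
    have := (GaussianFourier.integrable_cexp_neg_mul_sq_norm_add (b := (b : ℂ)) (V := E)
      (by simpa) 0 0).re
    refine this.congr (.of_forall fun x => ?_)
    simp only [zero_mul, add_zero]
    rw [← Complex.ofReal_neg, ← Complex.ofReal_pow, ← Complex.ofReal_mul, ← Complex.ofReal_exp]
    rfl
  set c : ℝ := (Real.pi / b) ^ (Module.finrank ℝ E / 2 : ℝ) with hc
  have hcpos : 0 < c := Real.rpow_pos_of_pos (by positivity) _
  have hκ : 0 ≤ c⁻¹ := by positivity
  refine ⟨c⁻¹, hκ, ?_⟩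
  have hfin : IsFiniteMeasure (volume.withDensity fun x : E =>
      ENNReal.ofReal (c⁻¹ * Real.exp (-b * ‖x‖ ^ 2))) :=
    isFiniteMeasure_withDensity_ofReal (hint.const_mul _).2
  refine Measure.ext_of_charFun (funext fun t => ?_)
  -- With linear coefficient `I` the Gaussian integral is a Fourier integral, so the characteristic
  -- functions can be compared.
  have h := GaussianFourier.integral_cexp_neg_mul_sq_norm_add (b := (b : ℂ)) (V := E)
    (by simpa) Complex.I t
  rw [hP, charFun_apply, integral_withDensity_eq_integral_toReal_smul (by fun_prop)
    (.of_forall fun _ => ENNReal.ofReal_lt_top)]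
  have hpt : ∀ x : E, (ENNReal.ofReal (c⁻¹ * Real.exp (-b * ‖x‖ ^ 2))).toReal •
      Complex.exp (inner ℝ x t * Complex.I) =
      (c⁻¹ : ℂ) * Complex.exp (-b * ‖x‖ ^ 2 + Complex.I * (inner ℝ t x : ℝ)) := fun x => by
    rw [ENNReal.toReal_ofReal (by positivity), Complex.exp_add, real_inner_comm, Complex.real_smul]
    push_cast
    ring_nf
  simp_rw [hpt]
  rw [integral_const_mul, h]
  have hcc : ((Real.pi : ℂ) / b) ^ ((Module.finrank ℝ E : ℂ) / 2) = c := by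
    rw [hc, Complex.ofReal_cpow (by positivity)]
    push_cast
    rfl
  rw [hcc, ← mul_assoc, inv_mul_cancel₀ (by exact_mod_cast hcpos.ne'), one_mul, Complex.I_sq]
  push_cast
  ring_nf

open Set Metric in
/-- Integration in polar coordinates. -/
theorem lintegral_norm_direction {E : Type*} [NormedAddCommGroup E] [NormedSpace ℝ E]
    [FiniteDimensional ℝ E] [Nontrivial E] [MeasurableSpace E] [BorelSpace E] (μ : Measure E)
    [μ.IsAddHaarMeasure] {f : ℝ → E → ENNReal} (hf : Measurable (Function.uncurry f)) :
    ∫⁻ x, f ‖x‖ (‖x‖⁻¹ • x) ∂μ =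
      ∫⁻ e : sphere (0 : E) 1, (∫⁻ r in Ioi (0 : ℝ),
        ENNReal.ofReal (r ^ (Module.finrank ℝ E - 1)) * f r e) ∂μ.toSphere := by
  have hf' : Measurable fun z : sphere (0 : E) 1 × Ioi (0 : ℝ) => f z.2 z.1 :=
    hf.comp (by fun_prop : Measurable fun z : sphere (0 : E) 1 × Ioi (0 : ℝ) =>
      ((z.2 : ℝ), (z.1 : E)))
  calc ∫⁻ x, f ‖x‖ (‖x‖⁻¹ • x) ∂μ
      = ∫⁻ x : ({0}ᶜ : Set E), f ‖x.1‖ (‖x.1‖⁻¹ • x.1) ∂μ.comap Subtype.val := by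
        rw [lintegral_subtype_comap (measurableSet_singleton _).compl
          fun x => f ‖x‖ (‖x‖⁻¹ • x), restrict_compl_singleton]
    _ = ∫⁻ z, f z.2 z.1 ∂μ.toSphere.prod (.volumeIoiPow (Module.finrank ℝ E - 1)) := by
        rw [← μ.measurePreserving_homeomorphUnitSphereProd.lintegral_comp hf']
        simp
    _ = _ := by
        rw [lintegral_prod _ hf'.aemeasurable]
        refine lintegral_congr fun e => ?_
        rw [Measure.volumeIoiPow, lintegral_withDensity_eq_lintegral_mul _ (by fun_prop)
          (show Measurable fun r : Ioi (0 : ℝ) => f r e from hf'.comp measurable_prodMk_left)]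
        exact lintegral_subtype_comap measurableSet_Ioi
          fun r => ENNReal.ofReal (r ^ (Module.finrank ℝ E - 1)) * f r e

namespace RandClust

/-! ### The scaled chi law as the law of a Gaussian norm -/

theorem scaledChiPDF_of_nonpos (p : ℕ) (c : ℝ) {u : ℝ} (hu : u ≤ 0) : scaledChiPDF p c u = 0 :=
  if_neg hu.not_gt

/-- The normalizing constant of the density of `c · χ_p`. -/
noncomputable def chiConst (p : ℕ) (c : ℝ) : ℝ :=
  c⁻¹ * (2 ^ (1 - (p : ℝ) / 2) / Real.Gamma ((p : ℝ) / 2)) * (c ^ ((p : ℝ) - 1))⁻¹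

theorem chiConst_pos {p : ℕ} (hp : 0 < p) {c : ℝ} (hc : 0 < c) : 0 < chiConst p c := by
  have : 0 < Real.Gamma ((p : ℝ) / 2) := Real.Gamma_pos_of_pos (by positivity)
  unfold chiConst
  positivity

theorem scaledChiPDF_of_pos (p : ℕ) {c u : ℝ} (hc : 0 < c) (hu : 0 < u) :
    scaledChiPDF p c u =
      chiConst p c * (u ^ ((p : ℝ) - 1) * Real.exp (-(1 / (2 * c ^ 2)) * u ^ 2)) := by
  rw [scaledChiPDF, if_pos hu, chiConst, Real.div_rpow hu.le hc.le,
    show -(u / c) ^ 2 / 2 = -(1 / (2 * c ^ 2)) * u ^ 2 by field_simp]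
  ring

theorem scaledChiPDF_pos {p : ℕ} (hp : 0 < p) {c u : ℝ} (hc : 0 < c) (hu : 0 < u) :
    0 < scaledChiPDF p c u := by
  have := chiConst_pos hp hc
  rw [scaledChiPDF_of_pos p hc hu]
  positivity

theorem scaledChiPDF_nonneg {p : ℕ} (hp : 0 < p) {c : ℝ} (hc : 0 < c) (u : ℝ) :
    0 ≤ scaledChiPDF p c u := by
  rcases le_or_gt u 0 with hu | hu
  · exact (scaledChiPDF_of_nonpos p c hu).ge
  · exact (scaledChiPDF_pos hp hc hu).le

@[fun_prop]
theorem measurable_scaledChiPDF (p : ℕ) (c : ℝ) : Measurable (scaledChiPDF p c) :=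
  Measurable.ite measurableSet_Ioi (by fun_prop) measurable_const

theorem integrable_scaledChiPDF {p : ℕ} (hp : 0 < p) {c : ℝ} (hc : 0 < c) :
    Integrable (scaledChiPDF p c) := by
  have hp' : (1 : ℝ) ≤ p := by exact_mod_cast hp
  have h := ((integrable_rpow_mul_exp_neg_mul_sq (b := 1 / (2 * c ^ 2)) (s := (p : ℝ) - 1)
    (by positivity) (by linarith)).const_mul (chiConst p c)).indicator (measurableSet_Ioi (a := 0))
  refine h.congr (.of_forall fun u => ?_)
  rcases le_or_gt u 0 with hu | hu
  · rw [scaledChiPDF_of_nonpos p c hu, Set.indicator_of_notMem (by simpa using hu)]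
  · rw [scaledChiPDF_of_pos p hc hu, Set.indicator_of_mem (by simpa using hu)]

/-- The norm of a centred isotropic Gaussian vector is independent of its direction and follows a
scaled chi law. The second factor is the law of the direction. -/
theorem map_norm_direction_eq_prod {p : ℕ} (hp : 0 < p) (P : Measure (EuclideanSpace ℝ (Fin p)))
    [IsProbabilityMeasure P] {c : ℝ} (hc : 0 < c)
    (hP : ∀ t, charFun P t = Complex.exp (-(c ^ 2 * ‖t‖ ^ 2 / 2 : ℝ))) :
    ∃ σ : Measure (EuclideanSpace ℝ (Fin p)), IsFiniteMeasure σ ∧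
      P.map (fun x => (‖x‖, ‖x‖⁻¹ • x)) =
        (volume.withDensity fun u => ENNReal.ofReal (scaledChiPDF p c u)).prod σ := by
  have : Nontrivial (EuclideanSpace ℝ (Fin p)) :=
    Module.nontrivial_of_finrank_pos (R := ℝ) (by simpa)
  obtain ⟨κ, hκ, rfl⟩ := eq_withDensity_of_charFun P (b := 1 / (2 * c ^ 2)) (by positivity)
    fun t => by rw [hP]; congr 3; field_simp; norm_num
  have hD := chiConst_pos hp hc
  let σ₀ := (volume : Measure (EuclideanSpace ℝ (Fin p))).toSphere
  -- The radial density agrees with the chi density up to a constant. The ratio is absorbed into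
  -- `σ`, so neither normalizing constant has to be evaluated.
  refine ⟨ENNReal.ofReal (κ / chiConst p c) • σ₀.map Subtype.val,
    ⟨by
      rw [Measure.smul_apply, smul_eq_mul]
      exact ENNReal.mul_lt_top ENNReal.ofReal_lt_top (measure_lt_top _ _)⟩, ?_⟩
  refine Measure.ext_of_lintegral _ fun F hF => ?_
  have hF' : ∀ e : EuclideanSpace ℝ (Fin p), Measurable fun r => F (r, e) := fun e =>
    hF.comp measurable_prodMk_right
  rw [lintegral_map hF (by fun_prop), lintegral_withDensity_eq_lintegral_mul _ (by fun_prop)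
    (by fun_prop : Measurable fun x : EuclideanSpace ℝ (Fin p) => F (‖x‖, ‖x‖⁻¹ • x))]
  have hpolar := lintegral_norm_direction (volume : Measure (EuclideanSpace ℝ (Fin p)))
    (f := fun r e => ENNReal.ofReal (κ * Real.exp (-(1 / (2 * c ^ 2)) * r ^ 2)) * F (r, e))
    (by unfold Function.uncurry; fun_prop)
  refine Eq.trans hpolar ?_
  rw [lintegral_prod_symm _ hF.aemeasurable, lintegral_smul_measure,
    lintegral_map hF.lintegral_prod_left' measurable_subtype_coe, smul_eq_mul,
    ← lintegral_const_mul' _ _ ENNReal.ofReal_ne_top]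
  refine lintegral_congr fun e => ?_
  rw [lintegral_withDensity_eq_lintegral_mul _ (by fun_prop) (hF' e),
    ← lintegral_const_mul' _ _ ENNReal.ofReal_ne_top, ← lintegral_indicator measurableSet_Ioi]
  refine lintegral_congr fun r => ?_
  rcases le_or_gt r 0 with hr | hr
  · rw [Set.indicator_of_notMem (by simpa using hr)]
    simp [scaledChiPDF_of_nonpos p c hr]
  · rw [Set.indicator_of_mem (by simpa using hr), Pi.mul_apply, ← mul_assoc, ← mul_assoc,
      ← ENNReal.ofReal_mul (by positivity), ← ENNReal.ofReal_mul (by positivity),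
      scaledChiPDF_of_pos p hc hr, finrank_euclideanSpace_fin, ← Real.rpow_natCast,
      Nat.cast_sub hp, Nat.cast_one]
    congr 2
    field_simp

/-! ### Contrast and residual of independent Gaussian rows -/

open WithLp

/-- Characteristic functions multiply over coordinates and squared norms add in the exponent. This
puts all rows into one Hilbert space, where joint Gaussianity and covariances are available. -/
theorem map_toLp_pi_stdGaussian {ι E : Type*} [Fintype ι] [NormedAddCommGroup E]
    [InnerProductSpace ℝ E] [FiniteDimensional ℝ E] [MeasurableSpace E] [BorelSpace E] :
    (Measure.pi fun _ : ι => stdGaussian E).map (toLp 2) = stdGaussian (PiLp 2 fun _ : ι => E) := by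
  apply Measure.ext_of_charFun
  ext t
  rw [charFun_stdGaussian, charFun_pi]
  simp_rw [charFun_stdGaussian, ← Complex.exp_sum, ← Complex.ofReal_pow, PiLp.norm_sq_eq_of_L2]
  simp [Finset.sum_div, neg_div]

section

variable {ι E : Type*} [Fintype ι] [NormedAddCommGroup E] [InnerProductSpace ℝ E]

/-- The component of the residual of the rows of `z` after projecting on `v`. -/
noncomputable def residual (v : EuclideanSpace ℝ ι) (z : ι → E) : ι → E :=
  fun i => z i - (v i / ‖v‖ ^ 2) • ∑ j, v j • z j

/-- Identifies the adjoint of the contrast map. -/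
theorem inner_sum_smul (v : EuclideanSpace ℝ ι) (x : E) (z : PiLp 2 fun _ : ι => E) :
    inner ℝ x (∑ i, v i • z i) = inner ℝ (toLp 2 fun i => v i • x : PiLp 2 fun _ : ι => E) z := by
  simp [PiLp.inner_apply, inner_sum, real_inner_smul_left, real_inner_smul_right]

/-- Self-adjointness of the operator `I - v vᵀ / ‖v‖²`. -/
theorem inner_residual (v : EuclideanSpace ℝ ι) (y z : PiLp 2 fun _ : ι => E) :
    inner ℝ y (toLp 2 (residual v z) : PiLp 2 fun _ : ι => E) =
      inner ℝ (toLp 2 (residual v y) : PiLp 2 fun _ : ι => E) z := by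
  simp only [PiLp.inner_apply, residual, inner_sub_left, inner_sub_right,
    Finset.sum_sub_distrib, inner_sum, sum_inner, real_inner_smul_left, real_inner_smul_right,
    Finset.mul_sum]
  congr 1
  rw [Finset.sum_comm]
  refine Finset.sum_congr rfl fun i _ => Finset.sum_congr rfl fun j _ => ?_
  ring

/-- A residual has zero contrast. Through the two adjoints above, this inner product is the
covariance of contrast and residual. -/
theorem inner_smul_residual {v : EuclideanSpace ℝ ι} (hv : v ≠ 0) (x : E)
    (y : PiLp 2 fun _ : ι => E) :
    inner ℝ (toLp 2 fun i => v i • x : PiLp 2 fun _ : ι => E) (toLp 2 (residual v y)) = 0 := by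
  have h : ‖v‖ ^ 2 ≠ 0 := by simpa using hv
  rw [← inner_sum_smul]
  simp only [residual, smul_sub, Finset.sum_sub_distrib, smul_smul, ← Finset.sum_smul]
  rw [show ∑ i, v i * (v i / ‖v‖ ^ 2) = 1 by
    simp_rw [← mul_div_assoc, ← Finset.sum_div, ← sq, ← EuclideanSpace.real_norm_sq_eq]
    exact div_self h]
  simp

@[fun_prop]
theorem continuous_residual (v : EuclideanSpace ℝ ι) :
    Continuous (residual v : (ι → E) → ι → E) := by
  unfold residual
  fun_prop

variable [FiniteDimensional ℝ E] [MeasurableSpace E] [BorelSpace E]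

/-- Under independent standard Gaussian rows, the contrast along `v` is independent of the
residual. -/
theorem map_contrast_residual {v : EuclideanSpace ℝ ι} (hv : v ≠ 0) :
    (Measure.pi fun _ : ι => stdGaussian E).map (fun z => (∑ i, v i • z i, residual v z)) =
      ((Measure.pi fun _ : ι => stdGaussian E).map fun z => ∑ i, v i • z i).prod
        ((Measure.pi fun _ : ι => stdGaussian E).map (residual v)) := by
  let A : (PiLp 2 fun _ : ι => E) →ₗ[ℝ] E :=
    { toFun := fun z => ∑ i, v i • z i
      map_add' := fun x y => by simp [Finset.sum_add_distrib]
      map_smul' := fun c x => by simp [Finset.smul_sum, smul_comm c] }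
  have hA : ∀ z : PiLp 2 fun _ : ι => E, A z = ∑ i, v i • z i := fun z => rfl
  let R : (PiLp 2 fun _ : ι => E) →ₗ[ℝ] PiLp 2 fun _ : ι => E :=
    { toFun := fun z => toLp 2 (residual v z)
      map_add' := fun x y => by
        refine ofLp_injective 2 (funext fun i => ?_)
        simp only [residual, ofLp_add, Pi.add_apply, smul_add, Finset.sum_add_distrib]
        abel
      map_smul' := fun c x => by
        refine ofLp_injective 2 (funext fun i => ?_)
        simp only [residual, ofLp_smul, Pi.smul_apply, smul_comm _ c, ← Finset.smul_sum,
          RingHom.id_apply, smul_sub] }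
  have hR : ∀ z : PiLp 2 fun _ : ι => E, R z = toLp 2 (residual v z) := fun z => rfl
  -- One linear map carries both components, which makes them jointly Gaussian; vanishing covariance
  -- then suffices for independence.
  let L : (PiLp 2 fun _ : ι => E) →L[ℝ] E × PiLp 2 fun _ : ι => E := (A.prod R).toContinuousLinearMap
  have hind : IndepFun (fun z => A z) (fun z => R z) (stdGaussian (PiLp 2 fun _ : ι => E)) := by
    refine HasGaussianLaw.indepFun_of_covariance_inner ?_ fun x y => ?_
    · exact (IsGaussian.hasGaussianLaw_id (μ := stdGaussian (PiLp 2 fun _ : ι => E))).map L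
    · simp_rw [hA, hR, inner_sum_smul, inner_residual]
      rw [← covarianceBilin_apply_eq_cov IsGaussian.memLp_two_id, covarianceBilin_stdGaussian,
        innerSL_apply_apply, inner_smul_residual hv]
  have hAm : Measurable fun z : PiLp 2 fun _ : ι => E => A z := A.continuous_of_finiteDimensional.measurable
  have hRm : Measurable fun z : PiLp 2 fun _ : ι => E => (R z).ofLp :=
    (by fun_prop : Measurable (ofLp : (PiLp 2 fun _ : ι => E) → ι → E)).comp R.continuous_of_finiteDimensional.measurable
  have h := (indepFun_iff_map_prod_eq_prod_map_map hAm.aemeasurable hRm.aemeasurable).1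
    (hind.comp measurable_id (by fun_prop : Measurable (ofLp : (PiLp 2 fun _ : ι => E) → ι → E)))
  rw [← map_toLp_pi_stdGaussian, Measure.map_map (by fun_prop) (by fun_prop),
    Measure.map_map (by fun_prop) (by fun_prop), Measure.map_map (by fun_prop) (by fun_prop)] at h
  simpa [Function.comp_def, hA, hR] using h

/-- Pairing the contrast with `t` is pairing the whole array with `(v i • t)`, of norm `‖v‖ * ‖t‖`.
This is the isotropy hypothesis of `map_norm_direction_eq_prod` with `c = ‖v‖`. -/
theorem charFun_map_contrast (v : EuclideanSpace ℝ ι) (t : E) :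
    charFun ((Measure.pi fun _ : ι => stdGaussian E).map fun z => ∑ i, v i • z i) t =
      Complex.exp (-(‖v‖ ^ 2 * ‖t‖ ^ 2 / 2 : ℝ)) := by
  have h : (Measure.pi fun _ : ι => stdGaussian E).map (fun z => ∑ i, v i • z i) =
      (stdGaussian (PiLp 2 fun _ : ι => E)).map fun z => ∑ i, v i • z i := by
    rw [← map_toLp_pi_stdGaussian, Measure.map_map (by fun_prop) (by fun_prop)]
    rfl
  have h2 : ‖(toLp 2 fun i => v i • t : PiLp 2 fun _ : ι => E)‖ ^ 2 = ‖v‖ ^ 2 * ‖t‖ ^ 2 := by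
    simp [PiLp.norm_sq_eq_of_L2, norm_smul, mul_pow, Finset.sum_mul]
  rw [h, charFun_apply, integral_map (by fun_prop) (by fun_prop)]
  have hinner : ∀ z : PiLp 2 fun _ : ι => E, inner ℝ (∑ i, v i • z i) t =
      inner ℝ z (toLp 2 fun i => v i • t : PiLp 2 fun _ : ι => E) := fun z => by
    rw [real_inner_comm, inner_sum_smul, real_inner_comm]
  simp_rw [hinner]
  rw [← charFun_apply, charFun_stdGaussian, ← Complex.ofReal_pow, h2]
  push_cast
  ring_nf

end

/-! ### Whitening, and recovery of the data from the statistics -/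

theorem isUnit_det_sqrt {p : ℕ} {S : Matrix (Fin p) (Fin p) ℝ} (hS : S.PosDef) :
    IsUnit (CFC.sqrt S).det := by
  have h := congrArg Matrix.det (CFC.sqrt_mul_sqrt_self S hS.posSemidef.nonneg)
  rw [Matrix.det_mul] at h
  exact isUnit_of_mul_isUnit_left (h ▸ hS.det_pos.ne'.isUnit)

theorem invSqrtMul_sqrtMul {p : ℕ} {S : Matrix (Fin p) (Fin p) ℝ} (hS : S.PosDef)
    (v : EuclideanSpace ℝ (Fin p)) : invSqrtMul S (sqrtMul S v) = v := by
  simp [invSqrtMul, sqrtMul, Matrix.nonsing_inv_mul _ (isUnit_det_sqrt hS)]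

theorem sqrtMul_invSqrtMul {p : ℕ} {S : Matrix (Fin p) (Fin p) ℝ} (hS : S.PosDef)
    (v : EuclideanSpace ℝ (Fin p)) : sqrtMul S (invSqrtMul S v) = v := by
  simp [invSqrtMul, sqrtMul, Matrix.mul_nonsing_inv _ (isUnit_det_sqrt hS)]

theorem sqrtMul_eq {p : ℕ} (S : Matrix (Fin p) (Fin p) ℝ) (v : EuclideanSpace ℝ (Fin p)) :
    sqrtMul S v = Matrix.toEuclideanCLM (𝕜 := ℝ) (CFC.sqrt S) v := rfl

@[fun_prop]
theorem continuous_sqrtMul {p : ℕ} (S : Matrix (Fin p) (Fin p) ℝ) : Continuous (sqrtMul S) :=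
  (Matrix.toEuclideanCLM (𝕜 := ℝ) (CFC.sqrt S)).continuous

@[fun_prop]
theorem continuous_invSqrtMul {p : ℕ} (S : Matrix (Fin p) (Fin p) ℝ) :
    Continuous (invSqrtMul S) :=
  (Matrix.toEuclideanCLM (𝕜 := ℝ) (CFC.sqrt S)⁻¹).continuous

@[fun_prop]
theorem measurable_whitened {n p : ℕ} (S : Matrix (Fin p) (Fin p) ℝ) (M : Merge n) :
    Measurable (whitened S M : Data n p → _) := by
  unfold whitened
  exact (continuous_invSqrtMul S).measurable.comp (by fun_prop)

@[fun_prop]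
theorem measurable_statU {n p : ℕ} (S : Matrix (Fin p) (Fin p) ℝ) (M : Merge n) :
    Measurable (statU S M : Data n p → ℝ) :=
  (measurable_whitened S M).norm

@[fun_prop]
theorem measurable_aux {n p : ℕ} (S : Matrix (Fin p) (Fin p) ℝ) (M : Merge n) :
    Measurable (aux S M : Data n p → _) := by
  unfold aux
  fun_prop

theorem measurable_recon {n p : ℕ} (S : Matrix (Fin p) (Fin p) ℝ) (M : Merge n) :
    Measurable fun z : ℝ × EuclideanSpace ℝ (Fin p) × Data n p => recon S M z.1 z.2 := by
  unfold recon
  have h : Measurable fun z : ℝ × EuclideanSpace ℝ (Fin p) × Data n p => sqrtMul S z.2.1 :=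
    (continuous_sqrtMul S).measurable.comp (by fun_prop)
  fun_prop

/-- The data are recovered from the test statistic and the auxiliary statistics. -/
theorem recon_statU_aux {n p : ℕ} {S : Matrix (Fin p) (Fin p) ℝ} (hS : S.PosDef) (M : Merge n)
    (x : Data n p) : recon S M (statU S M x) (aux S M x) = x := by
  have h : statU S M x • sqrtMul S (aux S M x).1 = ∑ j, nu M j • x j := by
    rw [sqrtMul_eq, ← map_smul, aux, statU, smul_smul]
    have hW : (‖whitened S M x‖ * ‖whitened S M x‖⁻¹) • whitened S M x = whitened S M x := by
      rcases eq_or_ne (whitened S M x) 0 with h0 | h0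
      · simp [h0]
      · rw [mul_inv_cancel₀ (norm_ne_zero_iff.2 h0), one_smul]
    rw [hW, ← sqrtMul_eq, whitened, sqrtMul_invSqrtMul hS]
  ext1 i
  rw [recon, mul_comm, mul_smul, h]
  simp [aux]

/-- The least element of the first cluster is not in the second, so the contrast is nonzero there;
disjointness is not needed. -/
theorem nu_ne_zero {n : ℕ} {M : Merge n} {C : Finset (Finset (Fin n))} (hM : M ∈ candidates C) :
    nu M ≠ 0 := by
  have hlt : M.1.min < M.2.min := (Finset.mem_filter.1 hM).2
  have hne : M.1.Nonempty := Finset.nonempty_iff_ne_empty.2 fun h => by simp [h] at hlt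
  obtain ⟨i, hi⟩ := Finset.min_of_nonempty hne
  have hi1 : i ∈ M.1 := Finset.mem_of_min hi
  have hi2 : i ∉ M.2 := fun h => (Finset.min_le h).not_gt (hi ▸ hlt)
  have hcard : (M.1.card : ℝ) ≠ 0 := by exact_mod_cast (Finset.card_pos.2 ⟨i, hi1⟩).ne'
  intro h
  have := congrArg (fun v : EuclideanSpace ℝ (Fin n) => v i) h
  simp [nu, hi1, hi2, hcard] at this

theorem sum_nu_smul {n p : ℕ} (M : Merge n) (x : Data n p) :
    ∑ i, nu M i • x i = clusterMean x M.1 - clusterMean x M.2 := by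
  simp [nu, clusterMean, sub_smul, Finset.sum_sub_distrib, ite_smul, Finset.sum_ite_mem,
    Finset.smul_sum]

theorem matrixNormal_eq_map {n p : ℕ} (μ : Data n p) (S : Matrix (Fin p) (Fin p) ℝ) :
    matrixNormal μ S = (Measure.pi fun _ : Fin n => stdGaussian (EuclideanSpace ℝ (Fin p))).map
      fun z i => μ i + sqrtMul S (z i) := by
  unfold matrixNormal multivariateGaussian
  have hm : ∀ i, Measurable fun x : EuclideanSpace ℝ (Fin p) => μ i + sqrtMul S x := fun i => by
    fun_prop
  have : ∀ i, IsProbabilityMeasure ((stdGaussian (EuclideanSpace ℝ (Fin p))).map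
      fun x => μ i + sqrtMul S x) := fun i =>
    Measure.isProbabilityMeasure_map (hm i).aemeasurable
  exact (Measure.pi_map_pi fun i => (hm i).aemeasurable).symm

/-- Under the null hypothesis the test statistic follows a scaled chi law and is independent of the
auxiliary statistics. -/
theorem map_statU_aux {n p : ℕ} (hp : 0 < p) {S : Matrix (Fin p) (Fin p) ℝ} (hS : S.PosDef)
    (μ : Data n p) {M : Merge n} (hM : nu M ≠ 0) (hnull : clusterMean μ M.1 = clusterMean μ M.2) :
    ∃ Q : Measure (EuclideanSpace ℝ (Fin p) × Data n p), IsFiniteMeasure Q ∧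
      (matrixNormal μ S).map (fun x => (statU S M x, aux S M x)) =
        (volume.withDensity fun u => ENNReal.ofReal (scaledChiPDF p ‖nu M‖ u)).prod Q := by
  let E := EuclideanSpace ℝ (Fin p)
  let G := Measure.pi fun _ : Fin n => stdGaussian E
  let A : Data n p → E := fun z => ∑ i, nu M i • z i
  have hA : Measurable A := by fun_prop
  let h : Data n p → Data n p := fun r i => μ i + sqrtMul S (r i)
  have hh : Measurable h := by fun_prop
  -- The null hypothesis enters here: the contrast of `μ` vanishes. Therefore whitening returns the
  -- contrast of the noise, and `residual` leaves `μ` unchanged.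
  have hsum : ∀ z, ∑ i, nu M i • h z i = sqrtMul S (A z) := fun z => by
    simp only [h, smul_add, Finset.sum_add_distrib]
    rw [sum_nu_smul, hnull, sub_self, zero_add]
    simp only [sqrtMul_eq, A, map_sum, map_smul]
  have hwhit : ∀ z, whitened S M (h z) = A z := fun z => by
    rw [whitened, hsum, invSqrtMul_sqrtMul hS]
  have haux : ∀ z, aux S M (h z) = (‖A z‖⁻¹ • A z, h (residual (nu M) z)) := fun z => by
    rw [aux, hwhit]
    congr 1
    ext1 i
    rw [hsum]
    simp only [h, residual, sqrtMul_eq, map_sub, map_smul, A, add_sub_assoc]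
  have : IsProbabilityMeasure (G.map A) := Measure.isProbabilityMeasure_map hA.aemeasurable
  obtain ⟨σ, hσ, hpolar⟩ := map_norm_direction_eq_prod hp (G.map A) (norm_pos_iff.2 hM)
    (charFun_map_contrast (nu M))
  have hRm : Measurable (residual (nu M) : Data n p → Data n p) :=
    (continuous_residual _).measurable
  refine ⟨σ.prod ((G.map (residual (nu M))).map h), inferInstance, ?_⟩
  -- Regroup as ((norm, direction), residual): polar independence is applied inside the first factor
  -- of contrast-residual independence.
  rw [← Measure.prodAssoc_prod, ← hpolar, Measure.map_prod_map _ _ (by fun_prop) hh,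
    ← map_contrast_residual hM, matrixNormal_eq_map]
  rw [Measure.map_map (by fun_prop) (by fun_prop), Measure.map_map (by fun_prop) (by fun_prop),
    Measure.map_map (by fun_prop) (by fun_prop)]
  congr 1
  ext1 z
  change (statU S M (h z), aux S M (h z)) = _
  rw [haux, statU, hwhit]
  rfl

/-! ### Selection probabilities and the law of the merges -/

section

variable {n p : ℕ} (d : Merge n → Data n p → ℝ) (τ : ℝ) (C : Finset (Finset (Fin n)))

theorem selProb_nonneg (M : Merge n) (x : Data n p) : 0 ≤ selProb d τ C M x := by
  unfold selProb
  split_ifs <;> positivity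

/-- Exponentials are positive for a scale of any sign. At scale zero, `1 / 0 = 0` turns the softmax
into the uniform law. -/
theorem selProb_pos {M : Merge n} (hM : M ∈ candidates C) (x : Data n p) :
    0 < selProb d τ C M x := by
  rw [selProb, if_pos hM]
  exact div_pos (Real.exp_pos _) (Finset.sum_pos (fun _ _ => Real.exp_pos _) ⟨M, hM⟩)

theorem selProb_le_one (M : Merge n) (x : Data n p) : selProb d τ C M x ≤ 1 := by
  unfold selProb
  split_ifs with hM
  · exact div_le_one_of_le₀ (Finset.single_le_sum
      (f := fun M' => Real.exp (-(1 / temp d τ C x) * d M' x))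
      (fun _ _ => (Real.exp_pos _).le) hM) (by positivity)
  · exact zero_le_one

@[fun_prop]
theorem measurable_selProb (hd : ∀ m, Measurable (d m)) (M : Merge n) :
    Measurable (selProb d τ C M) := by
  unfold selProb temp
  split_ifs <;> fun_prop

end

/-- Lets the random clusters be replaced by the observed ones on the event that the earlier merges
agree. -/
theorem existing_congr {n : ℕ} {m m' : ℕ → Merge n} :
    ∀ {s : ℕ}, (∀ r < s, m r = m' r) → existing m s = existing m' s
  | 0, _ => rfl
  | s + 1, h => by
    rw [existing, existing, existing_congr fun r hr => h r (hr.trans s.lt_succ_self),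
      h s s.lt_succ_self]

theorem measurableSet_past_inter {Ω : Type*} {n p : ℕ} (X : Ω → Data n p) (M : ℕ → Ω → Merge n)
    (m : ℕ → Merge n) (s : ℕ) {B : Set (Data n p)} (hB : MeasurableSet B) :
    MeasurableSet[past X M s] (X ⁻¹' B ∩ {ω | ∀ r < s, M r ω = m r}) := by
  refine MeasurableSet.inter ?_ ?_
  · exact (le_sup_left : _ ≤ past X M s) _ ⟨B, hB, rfl⟩
  · have : {ω | ∀ r < s, M r ω = m r} = ⋂ r : Fin s, M r ⁻¹' {m r} := by
      ext ω
      simp [Fin.forall_iff]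
    rw [this]
    refine MeasurableSet.iInter fun r => ?_
    exact ((le_iSup (fun r : Fin s => MeasurableSpace.comap (M r) ⊤) r).trans le_sup_right) _
      ⟨{m r}, trivial, rfl⟩

section

variable {Ω : Type*} [MeasurableSpace Ω] {P : Measure Ω} {n p : ℕ}
  {d : Merge n → Data n p → ℝ} {τ : ℝ} {X : Ω → Data n p} {t : ℕ} {M : ℕ → Ω → Merge n}

/-- There are finitely many merges, so measurability of single-merge events suffices; `past` at `s`
involves only merges before `s`, so `s = t + 1` is allowed. -/
theorem past_le (hX : Measurable X) (hM : IsRandomizedClustering P d τ X M t) {s : ℕ}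
    (hs : s ≤ t + 1) : past X M s ≤ ‹MeasurableSpace Ω› := by
  refine sup_le hX.comap_le (iSup_le fun r => ?_)
  rintro _ ⟨A, -, rfl⟩
  rw [← Set.biUnion_preimage_singleton]
  exact A.toFinite.measurableSet_biUnion fun m _ => hM.measurableSet_eq r (by omega) m

/-- The joint law of the data and the event that the first `s` merges are `m 0, …, m (s - 1)`. -/
theorem map_restrict_merges [IsProbabilityMeasure P] (hd : ∀ m, Measurable (d m))
    (hX : Measurable X) (hM : IsRandomizedClustering P d τ X M t) (m : ℕ → Merge n) :
    ∀ s ≤ t + 1, (P.restrict {ω | ∀ r < s, M r ω = m r}).map X = (P.map X).withDensity fun x =>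
      ENNReal.ofReal (∏ r ∈ Finset.range s, selProb d τ (existing m r) (m r) x)
  | 0, _ => by simp
  | s + 1, hs => by
    have ih := map_restrict_merges hd hX hM m s (by omega)
    let g : Data n p → ℝ := selProb d τ (existing m s) (m s)
    have hg : Measurable g := measurable_selProb d τ _ hd _
    have hprod : (fun x => ENNReal.ofReal
        (∏ r ∈ Finset.range (s + 1), selProb d τ (existing m r) (m r) x)) =
        (fun x => ENNReal.ofReal (∏ r ∈ Finset.range s, selProb d τ (existing m r) (m r) x)) *
          fun x => ENNReal.ofReal (g x) := by
      ext1 x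
      rw [Finset.prod_range_succ, ENNReal.ofReal_mul
        (Finset.prod_nonneg fun _ _ => selProb_nonneg _ _ _ _ _)]
      rfl
    rw [hprod, withDensity_mul _ (by fun_prop) (by fun_prop), ← ih]
    ext B hB
    set A := X ⁻¹' B ∩ {ω | ∀ r < s, M r ω = m r} with hA
    have hle := past_le hX hM (s := s) (by omega)
    have hAp := measurableSet_past_inter X M m s hB
    have hAm : MeasurableSet A := hle _ hAp
    have hev : MeasurableSet {ω | M s ω = m s} := hM.measurableSet_eq s (by omega) _
    have hset : X ⁻¹' B ∩ {ω | ∀ r < s + 1, M r ω = m r} = A ∩ {ω | M s ω = m s} := by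
      ext ω
      simp only [hA, Set.mem_inter_iff, Set.mem_ofPred_eq, Nat.forall_lt_succ_right, and_assoc]
    -- `A` belongs to the past, so the conditional probability may be integrated over it; on `A` it
    -- equals `g (X ω)`, because the earlier merges are the observed ones.
    have hint : ∫ ω in A, g (X ω) ∂P = P.real (A ∩ {ω | M s ω = m s}) := by
      have h1 : ∫ ω in A, g (X ω) ∂P = ∫ ω in A,
          (P[Set.indicator {ω | M s ω = m s} (fun _ => (1 : ℝ)) | past X M s]) ω ∂P := by
        refine setIntegral_congr_ae hAm ?_
        filter_upwards [hM.condProb_eq s (by omega) (m s)] with ω hω hωA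
        rw [hω, existing_congr hωA.2]
      rw [h1, setIntegral_condExp hle ((integrable_const _).indicator hev) hAp,
        integral_indicator hev, Measure.restrict_restrict hev]
      simp [Set.inter_comm, hA]
    rw [Measure.map_apply hX hB, Measure.restrict_apply (hX hB), hset, withDensity_apply _ hB,
      setLIntegral_map hB (by fun_prop) hX, Measure.restrict_restrict (hX hB), ← hA,
      ← ofReal_integral_eq_lintegral_ofReal, hint, ofReal_measureReal]
    · exact Integrable.of_bound (hg.comp hX).aestronglyMeasurable 1 (.of_forall fun ω => by
        rw [Real.norm_of_nonneg (selProb_nonneg _ _ _ _ _)]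
        exact selProb_le_one _ _ _ _ _)
    · exact .of_forall fun ω => selProb_nonneg _ _ _ _ _

end

/-! ### Measurability, positivity and integrability of the weight -/

section

variable {n p : ℕ} {d : Merge n → Data n p → ℝ} (τ : ℝ) (S : Matrix (Fin p) (Fin p) ℝ)
  (m : ℕ → Merge n) (t : ℕ)

theorem measurable_weight (hd : ∀ m, Measurable (d m)) :
    Measurable fun z : ℝ × EuclideanSpace ℝ (Fin p) × Data n p => weight d τ S m t z.2 z.1 := by
  unfold weight
  refine Measurable.mul (by fun_prop) (Finset.measurable_prod _ fun s _ => ?_)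
  exact (measurable_selProb d τ _ hd _).comp (measurable_recon S (m t))

theorem measurable_pValue (hd : ∀ m, Measurable (d m)) :
    Measurable fun z : ℝ × EuclideanSpace ℝ (Fin p) × Data n p => pValue d τ S m t z.1 z.2 := by
  have hw := measurable_weight τ S m t hd
  have hden : Measurable fun z : ℝ × EuclideanSpace ℝ (Fin p) × Data n p =>
      ∫ v in Set.Ioi 0, weight d τ S m t z.2 v := by
    refine (StronglyMeasurable.integral_prod_right (ν := volume.restrict (Set.Ioi 0))
      (f := fun (z : ℝ × EuclideanSpace ℝ (Fin p) × Data n p) v => weight d τ S m t z.2 v)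
      (Measurable.stronglyMeasurable ?_)).measurable
    exact hw.comp (by fun_prop : Measurable fun y :
      (ℝ × EuclideanSpace ℝ (Fin p) × Data n p) × ℝ => (y.2, y.1.2))
  have hnum : Measurable fun z : ℝ × EuclideanSpace ℝ (Fin p) × Data n p =>
      ∫ v in Set.Ioc 0 z.1, weight d τ S m t z.2 v := by
    -- The range of integration depends on the parameter; as an indicator it moves into the
    -- integrand, leaving a fixed measure.
    simp_rw [← integral_indicator measurableSet_Ioc]
    refine (StronglyMeasurable.integral_prod_right (ν := volume)
      (f := fun (z : ℝ × EuclideanSpace ℝ (Fin p) × Data n p) v =>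
        (Set.Ioc 0 z.1).indicator (weight d τ S m t z.2) v)
      (Measurable.stronglyMeasurable ?_)).measurable
    have hs : MeasurableSet {y : (ℝ × EuclideanSpace ℝ (Fin p) × Data n p) × ℝ |
        y.2 ∈ Set.Ioc 0 y.1.1} :=
      (measurableSet_lt measurable_const measurable_snd).inter
        (measurableSet_le measurable_snd (by fun_prop))
    exact (hw.comp (by fun_prop : Measurable fun y :
      (ℝ × EuclideanSpace ℝ (Fin p) × Data n p) × ℝ => (y.2, y.1.2))).indicator hs
  exact measurable_const.sub (hnum.div hden)

variable {τ S m t}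

theorem weight_pos (hp : 0 < p) (hm : IsMergeSequence m t)
    (a : EuclideanSpace ℝ (Fin p) × Data n p) {u : ℝ} (hu : 0 < u) :
    0 < weight d τ S m t a u :=
  mul_pos (scaledChiPDF_pos hp (norm_pos_iff.2 (nu_ne_zero (hm t le_rfl))) hu)
    (Finset.prod_pos fun s hs =>
      selProb_pos _ _ _ (hm s (Nat.lt_succ_iff.1 (Finset.mem_range.1 hs))) _)

theorem integrable_weight (hp : 0 < p) (hd : ∀ m, Measurable (d m)) (hm : IsMergeSequence m t)
    (a : EuclideanSpace ℝ (Fin p) × Data n p) : Integrable (weight d τ S m t a) := by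
  have hc := norm_pos_iff.2 (nu_ne_zero (hm t le_rfl))
  refine (integrable_scaledChiPDF hp hc).mono' ((measurable_weight τ S m t hd).comp
    measurable_prodMk_right).aestronglyMeasurable (.of_forall fun u => ?_)
  have h0 := scaledChiPDF_nonneg hp hc u
  have h1 : ∀ s, 0 ≤ selProb d τ (existing m s) (m s) (recon S (m t) u a) := fun s =>
    selProb_nonneg _ _ _ _ _
  rw [weight, Real.norm_of_nonneg (mul_nonneg h0 (Finset.prod_nonneg fun s _ => h1 s))]
  exact mul_le_of_le_one_right h0
    (Finset.prod_le_one (fun s _ => h1 s) fun s _ => selProb_le_one _ _ _ _ _)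

end

/-! ### Conditional uniformity of the p-value -/

/-- The joint law of the test statistic, the auxiliary statistics and the event of the observed
merges. -/
theorem exists_measure_mergeEvent {Ω : Type*} [MeasurableSpace Ω] {P : Measure Ω}
    [IsProbabilityMeasure P] {n p : ℕ} (hp : 0 < p) {d : Merge n → Data n p → ℝ}
    (hd : ∀ m, Measurable (d m)) {τ : ℝ} {S : Matrix (Fin p) (Fin p) ℝ} (hS : S.PosDef)
    {μ : Data n p} {X : Ω → Data n p} (hX : Measurable X) (hlaw : P.map X = matrixNormal μ S)
    {t : ℕ} {M : ℕ → Ω → Merge n} (hM : IsRandomizedClustering P d τ X M t)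
    {m : ℕ → Merge n} (hm : IsMergeSequence m t)
    (hnull : clusterMean μ (m t).1 = clusterMean μ (m t).2) :
    ∃ Q : Measure (EuclideanSpace ℝ (Fin p) × Data n p),
      ∀ B : Set (ℝ × EuclideanSpace ℝ (Fin p) × Data n p), MeasurableSet B →
        P (mergeEvent M m t ∩ {ω | (statU S (m t) (X ω), aux S (m t) (X ω)) ∈ B}) =
          ∫⁻ a, (∫⁻ u in Set.Ioi 0 ∩ {u | (u, a) ∈ B},
            ENNReal.ofReal (weight d τ S m t a u)) ∂Q := by
  have hν := nu_ne_zero (hm t le_rfl)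
  obtain ⟨Q, hQ, hmap⟩ := map_statU_aux hp hS μ hν hnull
  refine ⟨Q, fun B hB => ?_⟩
  let T : Data n p → ℝ × EuclideanSpace ℝ (Fin p) × Data n p :=
    fun x => (statU S (m t) x, aux S (m t) x)
  have hT : Measurable T := by fun_prop
  let g : Data n p → ENNReal := fun x => ENNReal.ofReal
    (∏ s ∈ Finset.range (t + 1), selProb d τ (existing m s) (m s) x)
  have hg : Measurable g := by fun_prop
  have hg' : Measurable fun z : ℝ × EuclideanSpace ℝ (Fin p) × Data n p =>
      g (recon S (m t) z.1 z.2) := hg.comp (measurable_recon S (m t))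
  have hev : mergeEvent M m t = {ω | ∀ r < t + 1, M r ω = m r} := by
    simp only [mergeEvent, Nat.lt_succ_iff]
  have hF : Measurable (B.indicator fun z : ℝ × EuclideanSpace ℝ (Fin p) × Data n p =>
      g (recon S (m t) z.1 z.2)) := hg'.indicator hB
  calc P (mergeEvent M m t ∩ {ω | (statU S (m t) (X ω), aux S (m t) (X ω)) ∈ B})
      = (P.restrict (mergeEvent M m t)).map X (T ⁻¹' B) := by
        rw [Measure.map_apply hX (hT hB), Measure.restrict_apply (hX (hT hB)), Set.inter_comm]
        rfl
    -- Since `recon` inverts `T`, the selection density is a function of `T x` alone and can be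
    -- integrated against the product law.
    _ = ∫⁻ x, B.indicator (fun z => g (recon S (m t) z.1 z.2)) (T x) ∂matrixNormal μ S := by
        rw [hev, map_restrict_merges hd hX hM m (t + 1) le_rfl, hlaw,
          withDensity_apply _ (hT hB), ← lintegral_indicator (hT hB)]
        refine lintegral_congr fun x => ?_
        simp only [Set.indicator, T, recon_statU_aux hS, g]
        rfl
    _ = ∫⁻ a, (∫⁻ u, ENNReal.ofReal (scaledChiPDF p ‖nu (m t)‖ u) *
          B.indicator (fun z => g (recon S (m t) z.1 z.2)) (u, a)) ∂Q := by
        rw [← lintegral_map hF hT, hmap, lintegral_prod_symm _ hF.aemeasurable]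
        refine lintegral_congr fun a => ?_
        exact lintegral_withDensity_eq_lintegral_mul _ (by fun_prop)
          (hF.comp measurable_prodMk_right)
    _ = _ := by
        refine lintegral_congr fun a => ?_
        rw [← lintegral_indicator (s := Set.Ioi 0 ∩ {u | (u, a) ∈ B})
          (measurableSet_Ioi.inter (measurable_prodMk_right hB))]
        refine lintegral_congr fun u => ?_
        rcases le_or_gt u 0 with hu | hu
        · rw [scaledChiPDF_of_nonpos _ _ hu, ENNReal.ofReal_zero, zero_mul,
            Set.indicator_of_notMem fun h => hu.not_gt h.1]
        · by_cases hBu : (u, a) ∈ B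
          · have hu' : u ∈ Set.Ioi 0 ∩ {u | (u, a) ∈ B} := ⟨hu, hBu⟩
            rw [Set.indicator_of_mem hBu, Set.indicator_of_mem hu',
              ← ENNReal.ofReal_mul (scaledChiPDF_nonneg hp (norm_pos_iff.2 hν) u)]
            rfl
          · have hu' : u ∉ Set.Ioi 0 ∩ {u | (u, a) ∈ B} := fun h => hBu h.2
            rw [Set.indicator_of_notMem hBu, Set.indicator_of_notMem hu', mul_zero]

/-- The p-value is uniformly distributed given the observed merges. -/
theorem cond_pValue_le {Ω : Type*} [MeasurableSpace Ω] {P : Measure Ω}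
    [IsProbabilityMeasure P] {n p : ℕ} (hp : 0 < p) {d : Merge n → Data n p → ℝ}
    (hd : ∀ m, Measurable (d m)) {τ : ℝ} {S : Matrix (Fin p) (Fin p) ℝ} (hS : S.PosDef)
    {μ : Data n p} {X : Ω → Data n p} (hX : Measurable X) (hlaw : P.map X = matrixNormal μ S)
    {t : ℕ} {M : ℕ → Ω → Merge n} (hM : IsRandomizedClustering P d τ X M t)
    {m : ℕ → Merge n} (hm : IsMergeSequence m t)
    (hnull : clusterMean μ (m t).1 = clusterMean μ (m t).2) {α : ℝ} (hα0 : 0 ≤ α) (hα1 : α ≤ 1) :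
    P[{ω | pValue d τ S m t (statU S (m t) (X ω)) (aux S (m t) (X ω)) ≤ α} | mergeEvent M m t]
      = ENNReal.ofReal α := by
  obtain ⟨Q, hQ⟩ := exists_measure_mergeEvent hp hd hS hX hlaw hM hm hnull
  have hev : MeasurableSet (mergeEvent M m t) := by
    simp only [mergeEvent, Set.ofPred_forall]
    exact .iInter fun s => .iInter fun hs => hM.measurableSet_eq s hs _
  -- A null event would force the density `∏ selProb` to vanish almost everywhere, but it is
  -- positive everywhere.
  have hE : P (mergeEvent M m t) ≠ 0 := by
    have h : mergeEvent M m t = {ω | ∀ r < t + 1, M r ω = m r} := by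
      simp only [mergeEvent, Nat.lt_succ_iff]
    have hmap := map_restrict_merges hd hX hM m (t + 1) le_rfl
    intro h0
    rw [← h, Measure.restrict_eq_zero.2 h0, Measure.map_zero, eq_comm,
      withDensity_eq_zero_iff (by fun_prop)] at hmap
    have : IsProbabilityMeasure (P.map X) := Measure.isProbabilityMeasure_map hX.aemeasurable
    obtain ⟨x, hx⟩ := hmap.exists
    exact (ENNReal.ofReal_pos.2 (Finset.prod_pos fun s hs =>
      selProb_pos _ _ _ (hm s (Nat.lt_succ_iff.1 (Finset.mem_range.1 hs))) x)).ne' hx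
  have huniv := hQ Set.univ .univ
  have hB := hQ {z | pValue d τ S m t z.1 z.2 ≤ α}
    (measurableSet_le (measurable_pValue τ S m t hd) measurable_const)
  simp only [Set.mem_univ, Set.ofPred_true, Set.inter_univ] at huniv
  simp only [Set.mem_ofPred_eq, pValue, condCDF] at hB
  -- On each fibre the mass of the rejection region is `α` times the full mass, and the full masses
  -- integrate to `P (mergeEvent M m t)`.
  simp_rw [lintegral_survival_le (fun v hv => weight_pos hp hm _ hv)
    (integrable_weight hp hd hm _) hα0 hα1] at hB
  rw [lintegral_const_mul' _ _ ENNReal.ofReal_ne_top, ← huniv] at hB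
  rw [cond_apply hev]
  simp only [pValue, condCDF]
  rw [hB, mul_comm (ENNReal.ofReal α), ← mul_assoc, ENNReal.inv_mul_cancel hE (measure_ne_top _ _),
    one_mul]

end RandClust

theorem mainTheorem5 {Ω : Type*} [MeasurableSpace Ω] (P : Measure Ω) [IsProbabilityMeasure P]
    {n p : ℕ} (hp : 0 < p)
    (d : RandClust.Merge n → RandClust.Data n p → ℝ) (hd : ∀ m, Measurable (d m))
    (τ : ℝ) (hτ : 0 < τ)
    (S : Matrix (Fin p) (Fin p) ℝ) (hS : S.PosDef) (μ : RandClust.Data n p)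
    (X : Ω → RandClust.Data n p) (hX : Measurable X)
    (hlaw : P.map X = RandClust.matrixNormal μ S)
    (t : ℕ) (M : ℕ → Ω → RandClust.Merge n)
    (hM : RandClust.IsRandomizedClustering P d τ X M t)
    (m : ℕ → RandClust.Merge n) (hm : RandClust.IsMergeSequence m t)
    (hnull : RandClust.clusterMean μ (m t).1 = RandClust.clusterMean μ (m t).2)
    (α : ℝ) (hα0 : 0 ≤ α) (hα1 : α ≤ 1) :
    P[{ω | RandClust.pValue d τ S m t (RandClust.statU S (m t) (X ω))
          (RandClust.aux S (m t) (X ω)) ≤ α} | RandClust.mergeEvent M m t]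
      = ENNReal.ofReal α :=
  RandClust.cond_pValue_le hp hd hS hX hlaw hM hm hnull hα0 hα1
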